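/- Let $d\in\mathbb N$, $\gamma>1$ and $$\rho(\gamma)=\frac1{2\gamma}\Big(\sqrt{(\gamma+1)^2-4e^{\frac1{2\gamma}-\frac12}\gamma^{3/2}}+\gamma-1\Big).$$ In rounds $t=1,2,\dots$ of online linear prediction, a feature vector $x_t\in\mathbb R^d$ is revealed (with $x_1\neq0$), the learner predicts $\hat y_t\in\mathbb R$, a label $y_t\in\mathbb R$ is revealed, and the loss $\ell(y_t,\hat y_t)$ is suffered, where $\ell:\mathbb R^2\to\mathbb R$ is convex and $1$-Lipschitz in its second argument. Let $\delta_t\in\mathbb R$ be a sub-gradient of $\ell(y_t,\cdot)$ at $\hat y_t$, and put $g_t=\delta_tx_t$, $h_t=\max_{s\le t}\|x_s\|$, $G_t=\sum_{s\le t}g_s$ and $V_t=\sum_{s\le t}g_sg_s^\top$. For $\varepsilon>0$ let $$\Psi_\varepsilon(G,V,h)=\frac{\varepsilon\exp\Big(\inf_{\lambda\ge0}\Big\{\tfrac12G^\top(\gamma h_1^2I+\gamma V+\lambda I)^{-1}G+\tfrac{\lambda\rho(\gamma)^2}{2h^2}\Big\}\Big)}{\sqrt{\det(I+h_1^{-2}V)}}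 .$$ The learner predicts $\hat y_t=x_t^\top\hat w_t$ with the iterates $\hat w_t=-\nabla_G\Psi_1(G_{t-1},V_{t-1},h_t)$ of the $\varepsilon=1$ variant of Matrix-FreeGrad. (Equivalently, $\hat y_t=x_t^\top\hat w_t/h_1$ with the iterates $\hat w_t=-\nabla_G\Psi_{h_1}(G_{t-1},V_{t-1},h_t)$ of Matrix-FreeGrad.) Then: 1. The gradients defining $\hat w_t$ exist for all $t\ge1$. 2. The predictions are scale- and rotation-invariant: for fixed $(\delta_t)$, multiplying all feature vectors by $cO$, with $c>0$ and $O$ a special orthogonal $d\times d$ matrix, leaves every $\hat y_t$ unchanged. 3. For all $w\in\mathbb R^d$, all $T\ge1$, and all sequences $(x_t)$, $(y_t)$, $(\delta_t)$ as above, $$\sum_{t=1}^T\ell(y_t,\hat y_t)-\sum_{t=1}^T\ell(y_t,w^\top x_t)\ \le\ 1+\sqrt{Q_T^w\,\ln_+\!\big(\det(\gamma h_1^2\Sigma_T)^{-1}Q_T^w\big)},$$ where $\ln_+=\max\{0,\ln\}$, $\Sigma_T^{-1}=\gamma h_1^2I+\gamma\sum_{t=1}^Tg_tg_t^\top$, and,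 with the convention $0\ln0=0$, $$Q_T^w=\max\Big\{w^\top\Sigma_T^{-1}w,\ \tfrac12\Big(\tfrac{h_T^2\|w\|^2}{\rho(\gamma)^2}\ln\Big(\tfrac{h_T^2\|w\|^2}{\rho(\gamma)^2}\det(\gamma h_1^2\Sigma_T)^{-1}\Big)+w^\top\Sigma_T^{-1}w\Big)\Big\}.$$ -/

import Mathlib

open scoped NNReal Matrix RealInnerProductSpace

noncomputable section

namespace OnlineLinear

/-- The function `ρ(γ)` (used for `γ > 1`). -/
def rho (γ : ℝ) : ℝ :=
  1 / (2 * γ) *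
    (Real.sqrt ((γ + 1) ^ 2 - 4 * Real.exp (1 / (2 * γ) - 1 / 2) * γ ^ (3 / 2 : ℝ)) + γ - 1)

/-- The positive part of the logarithm, `ln₊ r = 0 ∨ ln r`. -/
def lnPlus (r : ℝ) : ℝ := max 0 (Real.log r)

variable {d : ℕ}

/-- The hints `h_t = max_{1 ≤ s ≤ t} ‖x_s‖` (rounds are numbered from `1`). -/
def hint (x : ℕ → EuclideanSpace ℝ (Fin d)) (t : ℕ) : ℝ :=
  ((Finset.Icc 1 t).sup (fun s => ‖x s‖₊) : ℝ≥0)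

/-- The observed sub-gradients `g_t = δ_t x_t`. -/
def subgrad (x : ℕ → EuclideanSpace ℝ (Fin d)) (δ : ℕ → ℝ) (t : ℕ) : EuclideanSpace ℝ (Fin d) :=
  δ t • x t

/-- `G_t = ∑_{s ≤ t} g_s`. -/
def gradSum (g : ℕ → EuclideanSpace ℝ (Fin d)) (t : ℕ) : EuclideanSpace ℝ (Fin d) :=
  ∑ s ∈ Finset.Icc 1 t, g s

/-- `V_t = ∑_{s ≤ t} g_s g_sᵀ`. -/
def gradGram (g : ℕ → EuclideanSpace ℝ (Fin d)) (t : ℕ) : Matrix (Fin d) (Fin d) ℝ :=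
  ∑ s ∈ Finset.Icc 1 t, Matrix.vecMulVec (g s).ofLp (g s).ofLp

/-- The Matrix-FreeGrad potential `Ψ(G, V, h)` with prod factor `γ`, first hint `h₁` and
leading factor (initial wealth) `ε`. -/
def potential (γ ε h₁ : ℝ) (G : EuclideanSpace ℝ (Fin d)) (V : Matrix (Fin d) (Fin d) ℝ)
    (h : ℝ) : ℝ :=
  ε * Real.exp (⨅ l : {l : ℝ // 0 ≤ l},
        (1 / 2 * (G.ofLp ⬝ᵥ
            (((γ * h₁ ^ 2) • (1 : Matrix (Fin d) (Fin d) ℝ) + γ • V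
              + (l : ℝ) • (1 : Matrix (Fin d) (Fin d) ℝ))⁻¹ *ᵥ G.ofLp))
          + (l : ℝ) * rho γ ^ 2 / (2 * h ^ 2)))
    / Real.sqrt (1 + (1 / h₁ ^ 2) • V).det

/-- The Matrix-FreeGrad iterate in round `t ≥ 1`, with leading factor `ε`:
`ŵ_t = -∇_G Ψ(G_{t-1}, V_{t-1}, h_t)`. -/
def matrixFreeGrad (γ ε : ℝ) (g : ℕ → EuclideanSpace ℝ (Fin d)) (h : ℕ → ℝ) (t : ℕ) :
    EuclideanSpace ℝ (Fin d) :=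
  -gradient (fun G => potential γ ε (h 1) G (gradGram g (t - 1)) (h t)) (gradSum g (t - 1))

/-- The prediction `ŷ_t = ⟨x_t, ŵ_t⟩` in round `t ≥ 1`, where `ŵ_t` is the Matrix-FreeGrad iterate
with leading factor `ε = 1`, fed with `g_s = δ_s x_s` (`s < t`) and the hint `h_t`. -/
def prediction (γ : ℝ) (x : ℕ → EuclideanSpace ℝ (Fin d)) (δ : ℕ → ℝ) (t : ℕ) : ℝ :=
  ⟪x t, matrixFreeGrad γ 1 (subgrad x δ) (hint x) t⟫

/-- Equivalently, `ŷ_t = ⟨x_t, ŵ_t⟩ / h₁` for the Matrix-FreeGrad iterates `ŵ_t` with leading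
factor `ε = h₁`. -/
theorem prediction_eq_div (γ : ℝ) (x : ℕ → EuclideanSpace ℝ (Fin d)) (δ : ℕ → ℝ) (t : ℕ)
    (h : hint x 1 ≠ 0) :
    prediction γ x δ t
      = ⟪x t, matrixFreeGrad γ (hint x 1) (subgrad x δ) (hint x) t⟫ / hint x 1 := by
  have key : ∀ (ε h₁ : ℝ) (V : Matrix (Fin d) (Fin d) ℝ) (r : ℝ),
      (fun G => potential γ ε h₁ G V r) = ε • (fun G => potential γ 1 h₁ G V r) := by
    intro ε h₁ V r
    funext G
    simp only [potential, Pi.smul_apply, smul_eq_mul, one_mul, mul_div_assoc]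
  have hg : matrixFreeGrad γ (hint x 1) (subgrad x δ) (hint x) t
      = hint x 1 • matrixFreeGrad γ 1 (subgrad x δ) (hint x) t := by
    unfold matrixFreeGrad gradient
    rw [key (hint x 1), fderiv_const_smul_field]
    simp
  rw [hg, real_inner_smul_right, prediction]
  field_simp

/-- `a` is a sub-gradient of `f : ℝ → ℝ` at `z`. -/
def IsSubgradientAt (f : ℝ → ℝ) (a z : ℝ) : Prop :=
  ∀ u : ℝ, f z + a * (u - z) ≤ f u

/-- The regret after `T` rounds of the predictions `p` against the linear model `w`. -/
def regret (loss : ℝ → ℝ → ℝ) (x : ℕ → EuclideanSpace ℝ (Fin d)) (y p : ℕ → ℝ) (T : ℕ)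
    (w : EuclideanSpace ℝ (Fin d)) : ℝ :=
  ∑ t ∈ Finset.Icc 1 T, loss (y t) (p t) - ∑ t ∈ Finset.Icc 1 T, loss (y t) ⟪w, x t⟫

/-- `Σ_T⁻¹ = γ h₁² I + γ ∑_{t ≤ T} g_t g_tᵀ` with `g_t = δ_t x_t`. -/
def precision (γ : ℝ) (x : ℕ → EuclideanSpace ℝ (Fin d)) (δ : ℕ → ℝ) (T : ℕ) :
    Matrix (Fin d) (Fin d) ℝ :=
  (γ * hint x 1 ^ 2) • (1 : Matrix (Fin d) (Fin d) ℝ) + γ • gradGram (subgrad x δ) T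

/-- `det(γ h₁² Σ_T)⁻¹`. -/
def detFactor (γ : ℝ) (x : ℕ → EuclideanSpace ℝ (Fin d)) (δ : ℕ → ℝ) (T : ℕ) : ℝ :=
  (((γ * hint x 1 ^ 2) • (precision γ x δ T)⁻¹).det)⁻¹

/-- The model complexity `Q_T^w`. -/
def complexity (γ : ℝ) (x : ℕ → EuclideanSpace ℝ (Fin d)) (δ : ℕ → ℝ) (T : ℕ)
    (w : EuclideanSpace ℝ (Fin d)) : ℝ :=
  max (w.ofLp ⬝ᵥ (precision γ x δ T *ᵥ w.ofLp))
    (1 / 2 * (hint x T ^ 2 * ‖w‖ ^ 2 / rho γ ^ 2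
          * Real.log (hint x T ^ 2 * ‖w‖ ^ 2 / rho γ ^ 2 * detFactor γ x δ T)
        + w.ofLp ⬝ᵥ (precision γ x δ T *ᵥ w.ofLp)))

/-- The feature vectors multiplied by `c O`. -/
def rescale (c : ℝ) (O : Matrix (Fin d) (Fin d) ℝ) (x : ℕ → EuclideanSpace ℝ (Fin d)) :
    ℕ → EuclideanSpace ℝ (Fin d) :=
  fun t => WithLp.toLp 2 ((c • O) *ᵥ (x t).ofLp)

end OnlineLinear

end

/-! The sub-gradient inequality bounds the regret by `∑ δ_t ŷ_t - ⟪w, G_T⟫`. A potential argument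
gives `∑ δ_t ŷ_t ≤ 1 - Ψ(G_T, V_T, h_T)` (`sum_mul_prediction_le`), so what remains is the
Fenchel-type bound on `-⟪w, G⟫ - Ψ(G)` (`neg_inner_sub_potential_le`).

One round must satisfy `Ψ(G + g, V + g gᵀ, h) ≤ Ψ(G, V, h) + ⟪g, ∇Ψ⟫` for `‖g‖ ≤ h`. By Lagrangian
duality the exponent of `Ψ` is the maximum of `v ⬝ᵥ G - ½ v ⬝ᵥ S v` over the ball of radius `ρ/h`.
The maximiser `v` is the gradient of the exponent, and Cauchy–Schwarz gives `|v ⬝ᵥ g| ≤ ρ`. Keeping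
the old multiplier after the update and applying Sherman–Morrison and the determinant lemma leaves a
scalar inequality in `a = v ⬝ᵥ g` and `b = g ⬝ᵥ M⁻¹ g` (`div_le_log_add_log`); `ρ(γ)` is defined so
that it holds for `|a| ≤ ρ`.

Invariance: a factor `c O` is absorbed by substituting `l ↦ c² l` in the infimum, and passes to the
predictions by the chain rule. -/

namespace OnlineLinear

/-! ### Scalar inequalities and the choice of `ρ` -/

/-- A second-order lower bound on the logarithm whose curvature is valid for `x ≥ 1 / γ - 1`. -/
theorem le_log_one_add {γ a : ℝ} (hγ : 1 ≤ γ) (ha : 1 ≤ γ * (1 + a)) :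
    a - γ * a ^ 2 / 2 ≤ Real.log (1 + a) := by
  have h1 : 0 < 1 + a := by
    by_contra h
    nlinarith
  rcases le_total 0 a with h0 | h0
  · have h := Real.le_log_one_add_of_nonneg h0
    refine le_trans ?_ h
    rw [le_div_iff₀ (by linarith)]
    nlinarith [mul_nonneg h0 h0, mul_nonneg (mul_nonneg h0 h0) h0,
      mul_nonneg (sub_nonneg.2 hγ) (mul_nonneg h0 h0),
      mul_nonneg (sub_nonneg.2 hγ) (mul_nonneg (mul_nonneg h0 h0) h0)]
  -- With `r = (1 + a)⁻¹ ≥ 1`, `log r ≤ sinh (log r) = (r - r⁻¹) / 2`; then expand `r = 1 - a + a²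
  -- r` and use `r ≤ γ`.
  · have h : Real.log (1 + a)⁻¹ ≤ Real.sinh (Real.log (1 + a)⁻¹) := by
      rw [Real.self_le_sinh_iff]
      exact Real.log_nonneg ((one_le_inv₀ h1).2 (by linarith))
    rw [Real.sinh_log (inv_pos.2 h1), Real.log_inv, inv_inv] at h
    have h2 : (1 + a)⁻¹ ≤ γ := by
      rw [inv_le_iff_one_le_mul₀ h1]; exact ha
    have h3 : (1 + a)⁻¹ = 1 - a + a ^ 2 * (1 + a)⁻¹ := by
      field_simp; ring
    have h4 : a ^ 2 * (1 + a)⁻¹ ≤ a ^ 2 * γ := mul_le_mul_of_nonneg_left h2 (sq_nonneg a)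
    linarith

/-- At `a₀ = (1 - √γ) / γ` the first factor is `√γ`, and the bound for the second is
`le_log_one_add` at `a₀`, exponentiated. This is one end point of the concavity argument; `-ρ` is
the other. -/
theorem exp_mul_sqrt_le {γ : ℝ} (hγ : 1 < γ) :
    Real.exp (1 / (2 * γ) - 1 / 2) * √γ
      ≤ (1 - γ * ((1 - √γ) / γ)) * (1 + (1 - √γ) / γ) := by
  have hγ0 : 0 < γ := by linarith
  have hs : √γ * √γ = γ := Real.mul_self_sqrt hγ0.le
  have hs1 : 1 < √γ := by rw [Real.lt_sqrt] <;> norm_num; exact hγ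
  have hA : γ * ((1 - √γ) / γ) = 1 - √γ := by field_simp
  have h1 : 1 ≤ γ * (1 + (1 - √γ) / γ) := by
    rw [mul_add, hA]; nlinarith
  have h2 : 0 < 1 + (1 - √γ) / γ := by
    by_contra h
    nlinarith
  have h := le_log_one_add hγ.le h1
  have h3 : (1 - √γ) / γ - γ * ((1 - √γ) / γ) ^ 2 / 2 = 1 / (2 * γ) - 1 / 2 := by
    field_simp
    nlinarith
  rw [h3] at h
  have h4 := (Real.le_log_iff_exp_le h2).1 h
  rw [hA, mul_comm]
  have : 1 - (1 - √γ) = √γ := by ring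
  rw [this]
  exact mul_le_mul_of_nonneg_left h4 (by linarith)

/-- `ρ(γ)` lies in `(0, 1)` and is a root of `(1 + γ ρ) (1 - ρ) = exp (1 / (2γ) - 1 / 2) √γ`. -/
theorem rho_spec {γ : ℝ} (hγ : 1 < γ) :
    0 < rho γ ∧ rho γ < 1 ∧
      (1 + γ * rho γ) * (1 - rho γ) = Real.exp (1 / (2 * γ) - 1 / 2) * √γ := by
  have hγ0 : 0 < γ := by linarith
  have hs : √γ * √γ = γ := Real.mul_self_sqrt hγ0.le
  have hpow : γ ^ (3 / 2 : ℝ) = γ * √γ := by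
    rw [show (3 / 2 : ℝ) = 1 + 1 / 2 by norm_num, Real.rpow_add hγ0, Real.rpow_one,
      ← Real.sqrt_eq_rpow]
  have hκ := exp_mul_sqrt_le hγ
  set κ := Real.exp (1 / (2 * γ) - 1 / 2) * √γ with hκd
  have hκ0 : 0 < κ := by positivity
  -- The quadratic `(1 - γ a) (1 + a)` reaches `κ` somewhere, so its maximum `(γ + 1)² / (4γ)` is at
  -- least `κ`: the discriminant is nonnegative.
  have hD : 0 ≤ (γ + 1) ^ 2 - 4 * (γ * κ) := by
    have hle := mul_le_mul_of_nonneg_left hκ hγ0.le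
    set a := (1 - √γ) / γ
    nlinarith [sq_nonneg ((1 - γ * a) - γ * (1 + a))]
  have hr : rho γ = 1 / (2 * γ) * (√((γ + 1) ^ 2 - 4 * (γ * κ)) + γ - 1) := by
    rw [rho, hpow, hκd]
    congr 5
    ring
  have hq := Real.sq_sqrt hD
  set q := √((γ + 1) ^ 2 - 4 * (γ * κ))
  have hq0 : 0 ≤ q := Real.sqrt_nonneg _
  have h2 : 2 * γ * rho γ = q + γ - 1 := by rw [hr]; field_simp
  have hpos : 0 < rho γ := by
    rw [hr]; exact mul_pos (by positivity) (by linarith)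
  have heq : (1 + γ * rho γ) * (1 - rho γ) = κ := by
    have h3 : q = 2 * γ * rho γ - γ + 1 := by linarith
    rw [h3] at hq
    have : γ * ((1 + γ * rho γ) * (1 - rho γ)) = γ * κ := by linarith
    exact mul_left_cancel₀ hγ0.ne' this
  refine ⟨hpos, ?_, heq⟩
  by_contra hlt
  have : (1 + γ * rho γ) * (1 - rho γ) ≤ 0 :=
    mul_nonpos_of_nonneg_of_nonpos (by positivity) (by linarith)
  linarith

/-- The product `(1 - γ a) (1 + a)` is concave, so it exceeds its values at the end points. -/
theorem exp_mul_sqrt_le_mul {γ a : ℝ} (hγ : 1 < γ) (ha : -rho γ ≤ a) (ha' : √γ ≤ 1 - γ * a) :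
    Real.exp (1 / (2 * γ) - 1 / 2) * √γ ≤ (1 - γ * a) * (1 + a) := by
  obtain ⟨-, -, h1⟩ := rho_spec hγ
  have h2 := exp_mul_sqrt_le hγ
  have hγ0 : 0 < γ := by linarith
  have h3 : a ≤ (1 - √γ) / γ := by
    rw [le_div_iff₀ hγ0]; linarith
  set κ := Real.exp (1 / (2 * γ) - 1 / 2) * √γ
  set a₀ := (1 - √γ) / γ
  set r := rho γ
  by_contra h
  push Not at h
  -- Were the value at `a` below `κ`, the chord over `[-ρ, a]` would have negative slope and the one
  -- over `[a, a₀]` positive slope, contrary to concavity.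
  have h4 : (a + r) * (1 - γ + γ * r - γ * a) < 0 := by nlinarith
  have h5 : 0 < (a₀ - a) * (1 - γ - γ * a - γ * a₀) := by nlinarith
  have h6 : 1 - γ + γ * r - γ * a < 0 := by
    by_contra h'
    nlinarith [mul_nonneg (show 0 ≤ a + r by linarith) (not_lt.1 h')]
  have h7 : 0 < 1 - γ - γ * a - γ * a₀ := by
    by_contra h'
    nlinarith [mul_nonneg (show 0 ≤ a₀ - a by linarith) (neg_nonneg.2 (not_lt.1 h'))]
  nlinarith [mul_nonneg hγ0.le (show 0 ≤ a₀ + r by linarith)]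

/-- The scalar inequality behind the one-round wealth bound. -/
theorem div_le_log_add_log {γ a b : ℝ} (hγ : 1 < γ) (ha : |a| ≤ rho γ) (hb : 0 ≤ b) :
    (2 * a + b - γ * a ^ 2) / (1 + γ * b) ≤ Real.log (1 + γ * b) + 2 * Real.log (1 + a) := by
  obtain ⟨hr0, hr1, hr⟩ := rho_spec hγ
  obtain ⟨ha1, ha2⟩ := abs_le.1 ha
  have hγ0 : 0 < γ := by linarith
  have h1a : 0 < 1 + a := by linarith
  set u := 1 + γ * b with hu
  have hu1 : 1 ≤ u := by nlinarith
  have hu0 : 0 < u := by linarith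
  set q := (1 - γ * a) ^ 2 / γ with hq
  have hexp : (2 * a + b - γ * a ^ 2) / u = 1 / γ - q / u := by
    rw [hq, hu]; field_simp; ring
  rw [hexp]
  have hs : √γ * √γ = γ := Real.mul_self_sqrt hγ0.le
  have hs1 : 1 < √γ := by rw [Real.lt_sqrt] <;> norm_num; exact hγ
  -- Over `u ≥ 1`, `q / u + log u` is least at `u = max 1 q`, hence the split.
  rcases le_total q 1 with hq1 | hq1
  · have h1 : 1 ≤ γ * (1 + a) := by
      rw [hq, div_le_one hγ0] at hq1
      have : 1 - γ * a ≤ √γ := Real.le_sqrt_of_sq_le hq1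
      nlinarith
    have h2 := le_log_one_add hγ.le h1
    have h3 : 1 - u⁻¹ ≤ Real.log u := Real.one_sub_inv_le_log_of_pos hu0
    have h4 : u⁻¹ ≤ 1 := inv_le_one_of_one_le₀ hu1
    have h5 : q / u = q * u⁻¹ := div_eq_mul_inv _ _
    have h6 : 1 / γ - q = 2 * a - γ * a ^ 2 := by rw [hq]; field_simp; ring
    nlinarith
  · have hq0 : 0 < q := by linarith
    have h1 : Real.log (q / u) ≤ q / u - 1 := Real.log_le_sub_one_of_pos (by positivity)
    rw [Real.log_div hq0.ne' hu0.ne'] at h1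
    -- With `u` eliminated, this is the logarithm of `γ exp (1/γ - 1) ≤ ((1 - γ a) (1 + a))²`.
    have hsuff : 1 / γ - 1 ≤ Real.log q + 2 * Real.log (1 + a) := by
      rcases le_total 0 a with h0 | h0
      · have h2 : 1 / γ ≤ 1 := by rw [div_le_one hγ0]; exact hγ.le
        have h3 := Real.log_nonneg hq1
        have h4 : 0 ≤ Real.log (1 + a) := Real.log_nonneg (by linarith)
        linarith
      · have h2 : √γ ≤ 1 - γ * a := by
          rw [hq, one_le_div hγ0] at hq1
          exact Real.sqrt_le_iff.2 ⟨by nlinarith, hq1⟩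
        have h3 := Real.log_le_log (by positivity) (exp_mul_sqrt_le_mul hγ ha1 h2)
        have h4 : 0 < 1 - γ * a := by linarith
        rw [Real.log_mul (Real.exp_pos _).ne' (by positivity), Real.log_exp,
          Real.log_mul h4.ne' h1a.ne', Real.log_sqrt hγ0.le] at h3
        rw [hq, Real.log_div (by positivity) hγ0.ne', Real.log_pow]
        have h5 : 1 / (2 * γ) = (1 / γ) / 2 := by field_simp
        push_cast
        linarith
    linarith

/-! ### Conjugate of the potential along a ray -/

/-- The tuning of the dual scale `η` in the regret bound. -/
theorem exists_scale_le {A B D : ℝ} (hA : 0 < A) (hB : 0 < B) (hD : 1 ≤ D) :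
    ∃ η : ℝ, 0 < η ∧ B ≤ η ^ 2 ∧
      A / (2 * η) + η * Real.log (η ^ 2 * D) / 2 - η ≤
        √(max A (1 / 2 * (B * Real.log (B * D) + A)) *
          lnPlus (D * max A (1 / 2 * (B * Real.log (B * D) + A)))) := by
  have hD0 : 0 < D := by linarith
  rcases le_total A (B * Real.log (B * D)) with h | h
  -- The left side is stationary in `η` when `η² log (η² D) = A`. Here that point does not exceed
  -- `B`, so the constraint `B ≤ η²` binds.
  · refine ⟨√B, Real.sqrt_pos.2 hB, (Real.sq_sqrt hB.le).ge, ?_⟩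
    set L := Real.log (B * D) with hL
    rw [max_eq_right (by linarith), Real.sq_sqrt hB.le]
    set r := 1 / 2 * (A / B + L) with hr
    have hsB : 0 < √B := Real.sqrt_pos.2 hB
    have hsq : √B * √B = B := Real.mul_self_sqrt hB.le
    have hL0 : 0 < L := by
      by_contra h'
      nlinarith
    have hAB : A / B ≤ L := by rw [div_le_iff₀ hB]; linarith
    have hr0 : 0 < r := by have := div_pos hA hB; rw [hr]; linarith
    have hQ : 1 / 2 * (B * L + A) = B * r := by rw [hr]; field_simp; ring
    have hval : A / (2 * √B) + √B * L / 2 - √B = √B * (r - 1) := by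
      have : A / (2 * √B) = √B * (1 / 2 * (A / B)) := by
        field_simp; linarith
      rw [this, hr]; ring
    rw [hQ, hval]
    rcases le_total r 1 with h1 | h1
    · exact le_trans (mul_nonpos_of_nonneg_of_nonpos hsB.le (by linarith)) (Real.sqrt_nonneg _)
    · apply Real.le_sqrt_of_sq_le
      have h2 : r ≤ lnPlus (D * (B * r)) := by
        refine le_trans ?_ (le_max_right _ _)
        rw [show D * (B * r) = (B * D) * r by ring, Real.log_mul (by positivity) hr0.ne', ← hL]
        have := Real.log_nonneg h1
        linarith
      have h3 : B * r * r ≤ B * r * lnPlus (D * (B * r)) :=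
        mul_le_mul_of_nonneg_left h2 (by positivity)
      refine le_trans ?_ h3
      rw [mul_pow, Real.sq_sqrt hB.le]
      nlinarith
  -- Here the stationary point `η² = z ≥ B` is admissible; it is found by the intermediate value
  -- theorem.
  · have hcont : ContinuousOn (fun z : ℝ => z * Real.log (z * D))
        (Set.Icc B (max B (max A (Real.exp 1)))) := by
      refine continuousOn_id.mul (ContinuousOn.log (by fun_prop) ?_)
      intro z hz
      have : 0 < z := lt_of_lt_of_le hB hz.1
      positivity
    have hend : A ≤ max B (max A (Real.exp 1)) * Real.log (max B (max A (Real.exp 1)) * D) := by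
      set Z := max B (max A (Real.exp 1))
      have h1 : A ≤ Z := le_trans (le_max_left _ _) (le_max_right _ _)
      have h2 : Real.exp 1 ≤ Z := le_trans (le_max_right _ _) (le_max_right _ _)
      have h0 : 0 < Z := lt_of_lt_of_le hA h1
      have h3 : 1 ≤ Real.log (Z * D) := by
        rw [Real.le_log_iff_exp_le (by positivity)]
        nlinarith
      nlinarith
    obtain ⟨z, hz, hzA⟩ := intermediate_value_Icc (le_max_left _ _) hcont ⟨h, hend⟩
    simp only at hzA
    have hz0 : 0 < z := lt_of_lt_of_le hB hz.1
    have hsz : 0 < √z := Real.sqrt_pos.2 hz0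
    have hsq : √z * √z = z := Real.mul_self_sqrt hz0.le
    refine ⟨√z, hsz, (Real.sq_sqrt hz0.le).symm ▸ hz.1, ?_⟩
    rw [max_eq_left (by linarith), Real.sq_sqrt hz0.le]
    set L := Real.log (z * D) with hL
    have hL0 : 0 < L := by
      by_contra h'
      nlinarith
    have hval : A / (2 * √z) + √z * L / 2 - √z = √z * (L - 1) := by
      have : A / (2 * √z) = √z * L / 2 := by
        rw [← hzA]; field_simp; linarith
      rw [this]; ring
    rw [hval]
    rcases le_total L 1 with h1 | h1
    · exact le_trans (mul_nonpos_of_nonneg_of_nonpos hsz.le (by linarith)) (Real.sqrt_nonneg _)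
    · apply Real.le_sqrt_of_sq_le
      have h2 : L ≤ lnPlus (D * A) := by
        refine le_trans ?_ (le_max_right _ _)
        rw [← hzA, show D * (z * L) = (z * D) * L by ring,
          Real.log_mul (by positivity) hL0.ne', ← hL]
        have := Real.log_nonneg h1
        linarith
      refine le_trans ?_ (mul_le_mul_of_nonneg_left h2 hA.le)
      rw [mul_pow, Real.sq_sqrt hz0.le, ← hzA]
      nlinarith

/-- The convex conjugate of the exponential, in the scaling used for the regret bound. -/
theorem sub_exp_div_sqrt_le {A D η : ℝ} (hD : 0 < D) (hη : 0 < η) (X : ℝ) :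
    X - Real.exp (X / η - A / (2 * η ^ 2)) / √D
      ≤ A / (2 * η) + η * Real.log (η ^ 2 * D) / 2 - η := by
  have hsD : 0 < √D := Real.sqrt_pos.2 hD
  have hlog : Real.log (η ^ 2 * D) / 2 = Real.log (η * √D) := by
    rw [Real.log_mul (by positivity) hD.ne', Real.log_mul hη.ne' hsD.ne', Real.log_pow,
      Real.log_sqrt hD.le]
    push_cast; ring
  set l := Real.log (η * √D) with hl
  have h1 : Real.exp (X / η - A / (2 * η ^ 2)) / √D
      = η * Real.exp (X / η - A / (2 * η ^ 2) - l) := by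
    rw [Real.exp_sub _ l, hl, Real.exp_log (by positivity)]
    field_simp
  have h2 := mul_le_mul_of_nonneg_left (Real.add_one_le_exp (X / η - A / (2 * η ^ 2) - l)) hη.le
  have h3 : η * (X / η - A / (2 * η ^ 2) - l + 1) = X - A / (2 * η) - η * l + η := by
    field_simp
  rw [h1, mul_div_assoc, hlog]
  linarith

/-! ### Positive definite forms and Lagrange multipliers -/

theorem posDef_add_smul_one {n : Type*} [DecidableEq n] {S : Matrix n n ℝ} (hS : S.PosDef) {l : ℝ} (hl : 0 ≤ l) :
    (S + l • (1 : Matrix n n ℝ)).PosDef :=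
  hS.add_posSemidef (Matrix.PosSemidef.one.smul hl)

section Quadratic

variable {n : Type*} [Fintype n]

theorem dotProduct_mulVec_comm_of_isHermitian {S : Matrix n n ℝ} (hS : S.IsHermitian)
    (u v : n → ℝ) : u ⬝ᵥ (S *ᵥ v) = v ⬝ᵥ (S *ᵥ u) := by
  have h : Sᵀ = S := by
    have := hS.eq
    rwa [Matrix.conjTranspose_eq_transpose_of_trivial] at this
  rw [Matrix.dotProduct_mulVec, ← Matrix.mulVec_transpose, h, dotProduct_comm]

theorem dotProduct_mulVec_self_nonneg {S : Matrix n n ℝ} (hS : S.PosSemidef) (v : n → ℝ) :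
    0 ≤ v ⬝ᵥ (S *ᵥ v) := by
  simpa using hS.dotProduct_mulVec_nonneg v

theorem dotProduct_self_nonneg_real (v : n → ℝ) : 0 ≤ v ⬝ᵥ v :=
  Finset.sum_nonneg fun i _ => mul_self_nonneg (v i)

theorem dotProduct_sq_le (u v : n → ℝ) : (u ⬝ᵥ v) ^ 2 ≤ (u ⬝ᵥ u) * (v ⬝ᵥ v) := by
  have h := Finset.sum_mul_sq_le_sq_mul_sq Finset.univ u v
  simpa [dotProduct, pow_two] using h

theorem posSemidef_vecMulVec_self (g : n → ℝ) : (Matrix.vecMulVec g g).PosSemidef := by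
  simpa using Matrix.posSemidef_vecMulVec_self_star g

theorem vecMulVec_mulVec_eq (a b v : n → ℝ) :
    Matrix.vecMulVec a b *ᵥ v = (b ⬝ᵥ v) • a := by
  ext i
  simp only [Matrix.mulVec, Matrix.vecMulVec_apply, dotProduct, Pi.smul_apply, smul_eq_mul,
    Finset.sum_mul]
  exact Finset.sum_congr rfl fun j _ => by ring

variable [DecidableEq n]

theorem inv_mulVec_eq {S : Matrix n n ℝ} (hS : S.PosDef) {u v : n → ℝ} (h : S *ᵥ v = u) :
    S⁻¹ *ᵥ u = v := by
  have := (Matrix.isUnit_iff_isUnit_det S).1 hS.isUnit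
  rw [← h, Matrix.mulVec_mulVec, Matrix.nonsing_inv_mul _ this, Matrix.one_mulVec]

theorem mulVec_inv_mulVec {S : Matrix n n ℝ} (hS : S.PosDef) (u : n → ℝ) :
    S *ᵥ (S⁻¹ *ᵥ u) = u := by
  have := (Matrix.isUnit_iff_isUnit_det S).1 hS.isUnit
  rw [Matrix.mulVec_mulVec, Matrix.mul_nonsing_inv _ this, Matrix.one_mulVec]

/-- Weak duality for a positive definite quadratic form. -/
theorem dotProduct_sub_le_inv {S : Matrix n n ℝ} (hS : S.PosDef) (u v : n → ℝ) :
    v ⬝ᵥ u - 1 / 2 * (v ⬝ᵥ (S *ᵥ v)) ≤ 1 / 2 * (u ⬝ᵥ (S⁻¹ *ᵥ u)) := by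
  set z := S⁻¹ *ᵥ u with hz
  have hu : u = S *ᵥ z := (mulVec_inv_mulVec hS u).symm
  have h := dotProduct_mulVec_self_nonneg hS.posSemidef (v - z)
  rw [Matrix.mulVec_sub, sub_dotProduct, dotProduct_sub, dotProduct_sub,
    dotProduct_mulVec_comm_of_isHermitian hS.isHermitian z v] at h
  rw [hu, dotProduct_comm (S *ᵥ z) z]
  linarith

theorem add_smul_one_mulVec (S : Matrix n n ℝ) (l : ℝ) (v : n → ℝ) :
    (S + l • (1 : Matrix n n ℝ)) *ᵥ v = S *ᵥ v + l • v := by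
  rw [Matrix.add_mulVec, Matrix.smul_mulVec, Matrix.one_mulVec]

/-- Pairing the equation with `v` gives `l (v ⬝ᵥ v) ≤ v ⬝ᵥ u`; Cauchy–Schwarz does the rest. A large
multiplier thus brings the solution inside any ball. -/
theorem sq_mul_dotProduct_inv_le {S : Matrix n n ℝ} (hS : S.PosDef) (u : n → ℝ) {l : ℝ}
    (hl : 0 ≤ l) {v : n → ℝ} (hv : (S + l • (1 : Matrix n n ℝ)) *ᵥ v = u) :
    l ^ 2 * (v ⬝ᵥ v) ≤ u ⬝ᵥ u := by
  have h1 := dotProduct_mulVec_self_nonneg hS.posSemidef v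
  have h2 : v ⬝ᵥ u = v ⬝ᵥ (S *ᵥ v) + l * (v ⬝ᵥ v) := by
    rw [← hv, add_smul_one_mulVec, dotProduct_add, dotProduct_smul, smul_eq_mul]
  have h3 := dotProduct_sq_le v u
  have h4 := dotProduct_self_nonneg_real v
  have h5 : (l * (v ⬝ᵥ v)) ^ 2 ≤ (v ⬝ᵥ u) ^ 2 :=
    pow_le_pow_left₀ (mul_nonneg hl h4) (by linarith) 2
  rcases h4.eq_or_lt with h | h
  · rw [← h]; simpa using dotProduct_self_nonneg_real u
  · have h6 : (v ⬝ᵥ v) * (l ^ 2 * (v ⬝ᵥ v)) ≤ (v ⬝ᵥ v) * (u ⬝ᵥ u) := by nlinarith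
    exact le_of_mul_le_mul_left h6 h

/-- Existence of a Lagrange multiplier for the ball constraint `‖v‖² ≤ r`. -/
theorem exists_multiplier {S : Matrix n n ℝ} (hS : S.PosDef) (u : n → ℝ) {r : ℝ} (hr : 0 < r) :
    ∃ l : ℝ, 0 ≤ l ∧ ∃ v : n → ℝ, (S + l • (1 : Matrix n n ℝ)) *ᵥ v = u ∧ v ⬝ᵥ v ≤ r ∧
      l * (v ⬝ᵥ v - r) = 0 := by
  set N : ℝ → n → ℝ := fun l => (S + l • (1 : Matrix n n ℝ))⁻¹ *ᵥ u with hN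
  have hNu : ∀ l, 0 ≤ l → (S + l • (1 : Matrix n n ℝ)) *ᵥ N l = u := fun l hl =>
    mulVec_inv_mulVec (posDef_add_smul_one hS hl) u
  rcases le_total (N 0 ⬝ᵥ N 0) r with h | h
  · exact ⟨0, le_rfl, N 0, hNu 0 le_rfl, h, zero_mul _⟩
  · have hA : Continuous (fun l : ℝ => S + l • (1 : Matrix n n ℝ)) := by fun_prop
    have hinv : ContinuousOn (fun l : ℝ => (S + l • (1 : Matrix n n ℝ))⁻¹) (Set.Ici 0) := by
      intro l hl
      refine ContinuousAt.continuousWithinAt ?_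
      have hdet : (S + l • (1 : Matrix n n ℝ)).det ≠ 0 :=
        (posDef_add_smul_one hS hl).det_pos.ne'
      simp only [Matrix.inv_def, Ring.inverse_eq_inv']
      exact (hA.matrix_det.continuousAt.inv₀ hdet).smul hA.matrix_adjugate.continuousAt
    have hNc : ContinuousOn N (Set.Ici 0) := by
      have : Continuous fun M : Matrix n n ℝ => M *ᵥ u :=
        continuous_id.matrix_mulVec continuous_const
      exact this.comp_continuousOn hinv
    have hc : ContinuousOn (fun l => N l ⬝ᵥ N l) (Set.Ici 0) := by
      have : Continuous fun v : n → ℝ => v ⬝ᵥ v := continuous_id.dotProduct continuous_id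
      exact this.comp_continuousOn hNc
    -- Chosen so that `l₁² ≥ u ⬝ᵥ u / r`, which puts `N l₁` inside the ball.
    set l₁ := √(u ⬝ᵥ u / r) + 1 with hl₁
    have hl₁0 : 0 < l₁ := by positivity
    have hend : N l₁ ⬝ᵥ N l₁ ≤ r := by
      have h1 := sq_mul_dotProduct_inv_le hS u hl₁0.le (hNu l₁ hl₁0.le)
      have h2 : u ⬝ᵥ u / r ≤ l₁ ^ 2 := by
        have := Real.sq_sqrt (div_nonneg (dotProduct_self_nonneg_real u) hr.le)
        nlinarith [Real.sqrt_nonneg (u ⬝ᵥ u / r)]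
      rw [div_le_iff₀ hr] at h2
      exact le_of_mul_le_mul_left (h1.trans h2) (by positivity)
    obtain ⟨l, hl, hlr⟩ := intermediate_value_Icc' hl₁0.le
      (hc.mono Set.Icc_subset_Ici_self) ⟨hend, h⟩
    simp only at hlr
    exact ⟨l, hl.1, N l, hNu l hl.1, hlr.le, by rw [hlr, sub_self, mul_zero]⟩

/-! ### The exponent and its duality -/

/-- The regularised exponent `inf_{l ≥ 0} ½ uᵀ (S + l I)⁻¹ u + l c` of the potential. -/
noncomputable def exponent (S : Matrix n n ℝ) (c : ℝ) (u : n → ℝ) : ℝ :=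
  ⨅ l : {l : ℝ // 0 ≤ l},
    (1 / 2 * (u ⬝ᵥ ((S + (l : ℝ) • (1 : Matrix n n ℝ))⁻¹ *ᵥ u)) + (l : ℝ) * c)

theorem bddBelow_exponent {S : Matrix n n ℝ} (hS : S.PosDef) {c : ℝ} (hc : 0 ≤ c) (u : n → ℝ) :
    BddBelow (Set.range fun l : {l : ℝ // 0 ≤ l} =>
      (1 / 2 * (u ⬝ᵥ ((S + (l : ℝ) • (1 : Matrix n n ℝ))⁻¹ *ᵥ u)) + (l : ℝ) * c)) := by
  refine ⟨0, ?_⟩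
  rintro _ ⟨⟨l, hl⟩, rfl⟩
  have := dotProduct_mulVec_self_nonneg (posDef_add_smul_one hS hl).inv.posSemidef u
  simp only
  positivity

theorem exponent_le {S : Matrix n n ℝ} (hS : S.PosDef) {c : ℝ} (hc : 0 ≤ c) (u : n → ℝ) {l : ℝ}
    (hl : 0 ≤ l) :
    exponent S c u ≤ 1 / 2 * (u ⬝ᵥ ((S + l • (1 : Matrix n n ℝ))⁻¹ *ᵥ u)) + l * c :=
  ciInf_le (bddBelow_exponent hS hc u) ⟨l, hl⟩

theorem exponent_mono {S : Matrix n n ℝ} (hS : S.PosDef) {c c' : ℝ} (hc : 0 ≤ c) (hcc : c ≤ c')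
    (u : n → ℝ) : exponent S c u ≤ exponent S c' u := by
  refine ciInf_mono (bddBelow_exponent hS hc u) ?_
  rintro ⟨l, hl⟩
  simp only
  gcongr

/-- Weak duality for each `l`: inside the ball the penalty `l/2 (v ⬝ᵥ v)` is at most `l * c`. -/
theorem le_exponent {S : Matrix n n ℝ} (hS : S.PosDef) {c : ℝ} (u : n → ℝ) {v : n → ℝ}
    (hv : v ⬝ᵥ v ≤ 2 * c) :
    v ⬝ᵥ u - 1 / 2 * (v ⬝ᵥ (S *ᵥ v)) ≤ exponent S c u := by
  have : Nonempty {l : ℝ // 0 ≤ l} := ⟨⟨0, le_rfl⟩⟩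
  refine le_ciInf ?_
  rintro ⟨l, hl⟩
  have h := dotProduct_sub_le_inv (posDef_add_smul_one hS hl) u v
  rw [add_smul_one_mulVec, dotProduct_add, dotProduct_smul, smul_eq_mul] at h
  simp only
  nlinarith

theorem exponent_zero_le {S : Matrix n n ℝ} (hS : S.PosDef) {c : ℝ} (hc : 0 ≤ c) :
    exponent S c 0 ≤ 0 := by
  simpa using exponent_le hS hc 0 le_rfl

/-- Strong duality: at a multiplier the exponent equals its dual lower bound. -/
theorem exponent_eq {S : Matrix n n ℝ} (hS : S.PosDef) {c : ℝ} (hc : 0 ≤ c) {u v : n → ℝ} {l : ℝ}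
    (hl : 0 ≤ l) (hu : (S + l • (1 : Matrix n n ℝ)) *ᵥ v = u) (hv : v ⬝ᵥ v ≤ 2 * c)
    (hlv : l * (v ⬝ᵥ v - 2 * c) = 0) :
    exponent S c u = 1 / 2 * (v ⬝ᵥ u) + l * c ∧
      exponent S c u = v ⬝ᵥ u - 1 / 2 * (v ⬝ᵥ (S *ᵥ v)) := by
  have h1 := exponent_le hS hc u hl
  rw [inv_mulVec_eq (posDef_add_smul_one hS hl) hu, dotProduct_comm u v] at h1
  have h2 := le_exponent hS u hv
  have h3 : v ⬝ᵥ u = v ⬝ᵥ (S *ᵥ v) + l * (v ⬝ᵥ v) := by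
    rw [← hu, add_smul_one_mulVec, dotProduct_add, dotProduct_smul, smul_eq_mul]
  constructor <;> linarith

/-- The multiplier `l` of `u` remains a candidate in the infimum at `u + e`. Together with
`le_exponent_add`, which keeps `v` instead, this pins the first-order behaviour of the exponent. -/
theorem exponent_le_add {S : Matrix n n ℝ} (hS : S.PosDef) {c : ℝ} (hc : 0 ≤ c) {u v : n → ℝ}
    {l : ℝ} (hl : 0 ≤ l) (hu : (S + l • (1 : Matrix n n ℝ)) *ᵥ v = u) (hv : v ⬝ᵥ v ≤ 2 * c)
    (hlv : l * (v ⬝ᵥ v - 2 * c) = 0) (e : n → ℝ) :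
    exponent S c (u + e) ≤ exponent S c u + v ⬝ᵥ e
      + 1 / 2 * (e ⬝ᵥ ((S + l • (1 : Matrix n n ℝ))⁻¹ *ᵥ e)) := by
  have hM := posDef_add_smul_one hS hl
  have h1 := exponent_le hS hc (u + e) hl
  rw [(exponent_eq hS hc hl hu hv hlv).1]
  rw [Matrix.mulVec_add, add_dotProduct, dotProduct_add, dotProduct_add,
    dotProduct_mulVec_comm_of_isHermitian hM.inv.isHermitian u e, inv_mulVec_eq hM hu,
    dotProduct_comm u v, dotProduct_comm e v] at h1
  linarith

theorem le_exponent_add {S : Matrix n n ℝ} (hS : S.PosDef) {c : ℝ} (hc : 0 ≤ c) {u v : n → ℝ}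
    {l : ℝ} (hl : 0 ≤ l) (hu : (S + l • (1 : Matrix n n ℝ)) *ᵥ v = u) (hv : v ⬝ᵥ v ≤ 2 * c)
    (hlv : l * (v ⬝ᵥ v - 2 * c) = 0) (e : n → ℝ) :
    exponent S c u + v ⬝ᵥ e ≤ exponent S c (u + e) := by
  have h := le_exponent hS (u + e) hv
  rw [dotProduct_add] at h
  rw [(exponent_eq hS hc hl hu hv hlv).2]
  linarith

/-! ### Rank-one updates and the one-round bound -/

/-- The matrix determinant lemma. -/
theorem det_add_vecMulVec {S : Matrix n n ℝ} (hS : S.PosDef) (k : ℝ) (g : n → ℝ) :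
    (S + k • Matrix.vecMulVec g g).det = S.det * (1 + k * (g ⬝ᵥ (S⁻¹ *ᵥ g))) := by
  have hdet := (Matrix.isUnit_iff_isUnit_det S).1 hS.isUnit
  have h := Matrix.det_add_replicateCol_mul_replicateRow (ι := Unit) hdet (k • g) g
  have h1 : Matrix.replicateCol Unit (k • g) * Matrix.replicateRow Unit g
      = k • Matrix.vecMulVec g g := by
    rw [← Matrix.smul_vecMulVec, Matrix.vecMulVec_eq Unit]
  rw [h1] at h
  rw [h, Matrix.mul_assoc, ← Matrix.replicateCol_mulVec, Matrix.mulVec_smul,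
    Matrix.det_unique (n := Unit)]
  rw [Matrix.add_apply, Matrix.one_apply_eq, Matrix.replicateRow_mul_replicateCol_apply,
    dotProduct_smul, smul_eq_mul]

/-- The quadratic form of the inverse after a rank-one update (Sherman–Morrison). -/
theorem inv_add_vecMulVec_quadratic {M : Matrix n n ℝ} (hM : M.PosDef) {k : ℝ} (hk : 0 ≤ k)
    (u g : n → ℝ) :
    (u + g) ⬝ᵥ ((M + k • Matrix.vecMulVec g g)⁻¹ *ᵥ (u + g)) =
      u ⬝ᵥ (M⁻¹ *ᵥ u) + (2 * (g ⬝ᵥ (M⁻¹ *ᵥ u)) + g ⬝ᵥ (M⁻¹ *ᵥ g) - k * (g ⬝ᵥ (M⁻¹ *ᵥ u)) ^ 2)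
        / (1 + k * (g ⬝ᵥ (M⁻¹ *ᵥ g))) := by
  set a := g ⬝ᵥ (M⁻¹ *ᵥ u) with ha
  set b := g ⬝ᵥ (M⁻¹ *ᵥ g) with hb
  have hb0 : 0 ≤ b := dotProduct_mulVec_self_nonneg hM.inv.posSemidef g
  have hpos : 0 < 1 + k * b := by positivity
  have hM' : (M + k • Matrix.vecMulVec g g).PosDef :=
    hM.add_posSemidef ((posSemidef_vecMulVec_self g).smul hk)
  -- The Sherman–Morrison solution: the correction along `M⁻¹ g` cancels the rank-one term.
  have hz : (M + k • Matrix.vecMulVec g g) *ᵥ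
      (M⁻¹ *ᵥ (u + g) - (k * (a + b) / (1 + k * b)) • (M⁻¹ *ᵥ g)) = u + g := by
    rw [Matrix.mulVec_sub, Matrix.mulVec_smul, Matrix.add_mulVec, Matrix.add_mulVec,
      mulVec_inv_mulVec hM, mulVec_inv_mulVec hM, Matrix.smul_mulVec, Matrix.smul_mulVec,
      vecMulVec_mulVec_eq, vecMulVec_mulVec_eq, Matrix.mulVec_add, dotProduct_add, ← ha, ← hb]
    ext i
    simp only [Pi.add_apply, Pi.sub_apply, Pi.smul_apply, smul_eq_mul]
    field_simp
    ring
  rw [inv_mulVec_eq hM' hz, dotProduct_sub, dotProduct_smul, Matrix.mulVec_add, dotProduct_add,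
    add_dotProduct, add_dotProduct,
    dotProduct_mulVec_comm_of_isHermitian hM.inv.isHermitian u g, ← ha, ← hb, smul_eq_mul]
  field_simp
  ring

/-- Weak duality for `S` at `v = (S + l I)⁻¹ g`, with `v ⬝ᵥ S v ≤ v ⬝ᵥ g`. It is needed because the
determinant in the potential contains `S`, while the exponent is updated through `S + l I`. -/
theorem inv_add_smul_one_quadratic_le {S : Matrix n n ℝ} (hS : S.PosDef) {l : ℝ} (hl : 0 ≤ l)
    (g : n → ℝ) :
    g ⬝ᵥ ((S + l • (1 : Matrix n n ℝ))⁻¹ *ᵥ g) ≤ g ⬝ᵥ (S⁻¹ *ᵥ g) := by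
  set v := (S + l • (1 : Matrix n n ℝ))⁻¹ *ᵥ g with hv
  have h := dotProduct_sub_le_inv hS g v
  have h1 : (S + l • (1 : Matrix n n ℝ)) *ᵥ v = g :=
    mulVec_inv_mulVec (posDef_add_smul_one hS hl) g
  have h2 : v ⬝ᵥ g = v ⬝ᵥ (S *ᵥ v) + l * (v ⬝ᵥ v) := by
    conv_lhs => rw [← h1]
    rw [add_smul_one_mulVec, dotProduct_add, dotProduct_smul, smul_eq_mul]
  have h3 := mul_nonneg hl (dotProduct_self_nonneg_real v)
  rw [dotProduct_comm g v]
  linarith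

/-- The one-round bound on the wealth, in the direction of the dual optimiser `v`. -/
theorem exp_exponent_step {S : Matrix n n ℝ} (hS : S.PosDef) {γ c : ℝ} (hγ : 1 < γ) (hc : 0 ≤ c)
    {u v g : n → ℝ} {l : ℝ} (hl : 0 ≤ l) (hu : (S + l • (1 : Matrix n n ℝ)) *ᵥ v = u)
    (hv : v ⬝ᵥ v ≤ 2 * c) (hlv : l * (v ⬝ᵥ v - 2 * c) = 0) (hg : |v ⬝ᵥ g| ≤ rho γ) :
    Real.exp (exponent (S + γ • Matrix.vecMulVec g g) c (u + g))
        / √(1 + γ * (g ⬝ᵥ (S⁻¹ *ᵥ g)))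
      ≤ Real.exp (exponent S c u) * (1 + v ⬝ᵥ g) := by
  have hγ0 : 0 ≤ γ := by linarith
  have hM := posDef_add_smul_one hS hl
  set M := S + l • (1 : Matrix n n ℝ) with hMd
  set b := g ⬝ᵥ (M⁻¹ *ᵥ g) with hb
  have hb0 : 0 ≤ b := dotProduct_mulVec_self_nonneg hM.inv.posSemidef g
  have hbb : b ≤ g ⬝ᵥ (S⁻¹ *ᵥ g) := inv_add_smul_one_quadratic_le hS hl g
  have hMu : M⁻¹ *ᵥ u = v := inv_mulVec_eq hM hu
  -- The old multiplier `l` is reused for the updated exponent.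
  have h1 := exponent_le (hS.add_posSemidef ((posSemidef_vecMulVec_self g).smul hγ0)) hc (u + g) hl
  rw [add_right_comm, ← hMd, inv_add_vecMulVec_quadratic hM hγ0, hMu, dotProduct_comm g v,
    dotProduct_comm u v, ← hb] at h1
  have h2 := (exponent_eq hS hc hl hu hv hlv).1
  have h3 := div_le_log_add_log hγ hg hb0
  set a := v ⬝ᵥ g
  obtain ⟨-, hr1, -⟩ := rho_spec hγ
  have h1a : 0 < 1 + a := by have := (abs_le.1 hg).1; linarith
  have hpos : 0 < 1 + γ * b := by positivity
  have h4 : exponent (S + γ • Matrix.vecMulVec g g) c (u + g)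
      ≤ exponent S c u + Real.log (√(1 + γ * b)) + Real.log (1 + a) := by
    rw [Real.log_sqrt hpos.le]
    linarith
  have h5 := Real.exp_le_exp.2 h4
  rw [Real.exp_add, Real.exp_add, Real.exp_log (Real.sqrt_pos.2 hpos), Real.exp_log h1a] at h5
  have h6 : √(1 + γ * b) ≤ √(1 + γ * (g ⬝ᵥ (S⁻¹ *ᵥ g))) := by
    apply Real.sqrt_le_sqrt; gcongr
  rw [div_le_iff₀ (lt_of_lt_of_le (Real.sqrt_pos.2 hpos) h6)]
  refine h5.trans ?_
  have h7 := mul_le_mul_of_nonneg_left h6 (mul_nonneg (Real.exp_pos (exponent S c u)).le h1a.le)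
  linarith

end Quadratic

/-! ### The potential and its one-round decrease -/

section Potential

variable {d : ℕ}

theorem inner_eq_dotProduct (a b : EuclideanSpace ℝ (Fin d)) : ⟪a, b⟫ = a.ofLp ⬝ᵥ b.ofLp := by
  rw [EuclideanSpace.inner_eq_star_dotProduct, star_trivial, dotProduct_comm]

theorem norm_sq_eq_dotProduct (a : EuclideanSpace ℝ (Fin d)) : ‖a‖ ^ 2 = a.ofLp ⬝ᵥ a.ofLp := by
  rw [← real_inner_self_eq_norm_sq, inner_eq_dotProduct]

/-- The exponent is differentiable, and its gradient is the dual optimiser. -/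
theorem hasGradientAt_exponent {S : Matrix (Fin d) (Fin d) ℝ} (hS : S.PosDef) {c : ℝ}
    (hc : 0 ≤ c) {G : EuclideanSpace ℝ (Fin d)} {v : Fin d → ℝ} {l : ℝ} (hl : 0 ≤ l)
    (hu : (S + l • (1 : Matrix (Fin d) (Fin d) ℝ)) *ᵥ v = G.ofLp) (hv : v ⬝ᵥ v ≤ 2 * c)
    (hlv : l * (v ⬝ᵥ v - 2 * c) = 0) :
    HasGradientAt (fun G : EuclideanSpace ℝ (Fin d) => exponent S c G.ofLp) (WithLp.toLp 2 v) G := by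
  rw [hasGradientAt_iff_isLittleO_nhds_zero]
  set L := Matrix.toEuclideanCLM (n := Fin d) (𝕜 := ℝ)
    (S + l • (1 : Matrix (Fin d) (Fin d) ℝ))⁻¹ with hL
  -- The two bounds place the remainder between `0` and `½ ⟪e, L e⟫`, hence it is `O(‖e‖²)`.
  refine Asymptotics.IsBigO.trans_isLittleO ?_
    (Asymptotics.isLittleO_norm_pow_id (E' := EuclideanSpace ℝ (Fin d)) one_lt_two)
  refine Asymptotics.IsBigO.of_bound (1 / 2 * ‖L‖) (Filter.Eventually.of_forall fun e => ?_)
  have h1 := exponent_le_add hS hc hl hu hv hlv e.ofLp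
  have h2 := le_exponent_add hS hc hl hu hv hlv e.ofLp
  have h3 : e.ofLp ⬝ᵥ ((S + l • (1 : Matrix (Fin d) (Fin d) ℝ))⁻¹ *ᵥ e.ofLp) = ⟪e, L e⟫ := by
    rw [inner_eq_dotProduct, hL, Matrix.ofLp_toEuclideanCLM]
  have h4 : ⟪e, L e⟫ ≤ ‖L‖ * ‖e‖ ^ 2 := by
    refine (real_inner_le_norm _ _).trans ?_
    have := mul_le_mul_of_nonneg_left (L.le_opNorm e) (norm_nonneg e)
    linarith
  rw [h3] at h1
  rw [inner_eq_dotProduct, WithLp.ofLp_add, Real.norm_eq_abs, norm_pow, norm_norm,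
    abs_of_nonneg (by linarith)]
  linarith

/-- The regularised Gram matrix `γ h₁² I + γ V`. -/
noncomputable def regGram (γ h₁ : ℝ) (V : Matrix (Fin d) (Fin d) ℝ) : Matrix (Fin d) (Fin d) ℝ :=
  (γ * h₁ ^ 2) • (1 : Matrix (Fin d) (Fin d) ℝ) + γ • V

theorem posDef_regGram {γ h₁ : ℝ} (hγ : 0 < γ) (hh : 0 < h₁) {V : Matrix (Fin d) (Fin d) ℝ}
    (hV : V.PosSemidef) : (regGram γ h₁ V).PosDef :=
  (Matrix.PosDef.one.smul (by positivity : 0 < γ * h₁ ^ 2)).add_posSemidef (hV.smul hγ.le)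

theorem posDef_one_add {h₁ : ℝ} {V : Matrix (Fin d) (Fin d) ℝ}
    (hV : V.PosSemidef) : (1 + (1 / h₁ ^ 2) • V).PosDef :=
  Matrix.PosDef.one.add_posSemidef (hV.smul (by positivity))

theorem regGram_eq_smul {γ h₁ : ℝ} (hh : 0 < h₁) (V : Matrix (Fin d) (Fin d) ℝ) :
    regGram γ h₁ V = (γ * h₁ ^ 2) • (1 + (1 / h₁ ^ 2) • V) := by
  rw [regGram, smul_add, smul_smul]
  congr 2
  field_simp

theorem potential_eq (γ h₁ h : ℝ) (G : EuclideanSpace ℝ (Fin d)) (V : Matrix (Fin d) (Fin d) ℝ) :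
    potential γ 1 h₁ G V h = Real.exp (exponent (regGram γ h₁ V) (rho γ ^ 2 / (2 * h ^ 2)) G.ofLp)
      / √(1 + (1 / h₁ ^ 2) • V).det := by
  simp only [potential, exponent, regGram, one_mul, mul_div_assoc]

/-- Since `regGram` is `γ h₁²` times the matrix in the determinant, the growth factor is exactly the
one divided out in `exp_exponent_step`. -/
theorem det_one_add_vecMulVec {γ h₁ : ℝ} (hγ : 0 < γ) (hh : 0 < h₁)
    {V : Matrix (Fin d) (Fin d) ℝ} (hV : V.PosSemidef) (g : Fin d → ℝ) :
    (1 + (1 / h₁ ^ 2) • (V + Matrix.vecMulVec g g)).det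
      = (1 + (1 / h₁ ^ 2) • V).det * (1 + γ * (g ⬝ᵥ ((regGram γ h₁ V)⁻¹ *ᵥ g))) := by
  have hA := posDef_one_add (h₁ := h₁) hV
  have hS := posDef_regGram hγ hh hV
  rw [smul_add, ← add_assoc, det_add_vecMulVec hA]
  have h1 := mulVec_inv_mulVec hS g
  set z := (regGram γ h₁ V)⁻¹ *ᵥ g
  rw [regGram_eq_smul hh, Matrix.smul_mulVec, ← Matrix.mulVec_smul] at h1
  rw [inv_mulVec_eq hA h1, dotProduct_smul, smul_eq_mul]
  congr 2
  field_simp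

/-- A single dual optimiser `v` gives both the gradient of the potential and the linear term of the
one-round bound. Its ball has radius `ρ/h`, whence `|v ⬝ᵥ g| ≤ ρ`. -/
theorem exists_hasGradientAt_potential {γ h₁ h : ℝ} (hγ : 1 < γ) (hh₁ : 0 < h₁) (hh : 0 < h)
    (G : EuclideanSpace ℝ (Fin d)) {V : Matrix (Fin d) (Fin d) ℝ} (hV : V.PosSemidef) :
    ∃ v : Fin d → ℝ,
      HasGradientAt (fun G => potential γ 1 h₁ G V h)
        (potential γ 1 h₁ G V h • WithLp.toLp 2 v) G ∧
      ∀ g : EuclideanSpace ℝ (Fin d), ‖g‖ ≤ h →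
        potential γ 1 h₁ (G + g) (V + Matrix.vecMulVec g.ofLp g.ofLp) h
          ≤ potential γ 1 h₁ G V h * (1 + v ⬝ᵥ g.ofLp) := by
  have hγ0 : 0 < γ := by linarith
  obtain ⟨hr0, -, -⟩ := rho_spec hγ
  set c := rho γ ^ 2 / (2 * h ^ 2) with hc
  have hc0 : 0 < c := by positivity
  have hS := posDef_regGram hγ0 hh₁ hV
  obtain ⟨l, hl, v, hu, hv, hlv⟩ := exists_multiplier hS G.ofLp (show 0 < 2 * c by positivity)
  refine ⟨v, ?_, fun g hg => ?_⟩
  · have h1 := (hasGradientAt_exponent hS hc0.le hl hu hv hlv).hasFDerivAt.exp.mul_const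
      (√(1 + (1 / h₁ ^ 2) • V).det)⁻¹
    rw [hasGradientAt_iff_hasFDerivAt]
    simp only [potential_eq, div_eq_mul_inv _ (√_)]
    rw [← hc]
    refine h1.congr_fderiv ?_
    ext e
    simp
    ring
  · have hvg : |v ⬝ᵥ g.ofLp| ≤ rho γ := by
      apply abs_le_of_sq_le_sq _ hr0.le
      have h1 := dotProduct_sq_le v g.ofLp
      have h2 : g.ofLp ⬝ᵥ g.ofLp ≤ h ^ 2 := by
        rw [← norm_sq_eq_dotProduct]
        exact pow_le_pow_left₀ (norm_nonneg g) hg 2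
      have h3 : 2 * c * h ^ 2 = rho γ ^ 2 := by rw [hc]; field_simp
      calc (v ⬝ᵥ g.ofLp) ^ 2 ≤ (v ⬝ᵥ v) * (g.ofLp ⬝ᵥ g.ofLp) := h1
        _ ≤ 2 * c * h ^ 2 := mul_le_mul hv h2 (dotProduct_self_nonneg_real _) (by positivity)
        _ = rho γ ^ 2 := h3
    have h1 := exp_exponent_step hS hγ hc0.le hl hu hv hlv hvg
    have hdet : 0 < √(1 + (1 / h₁ ^ 2) • V).det := Real.sqrt_pos.2 (posDef_one_add hV).det_pos
    have hreg : regGram γ h₁ (V + Matrix.vecMulVec g.ofLp g.ofLp)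
        = regGram γ h₁ V + γ • Matrix.vecMulVec g.ofLp g.ofLp := by
      rw [regGram, regGram, smul_add, add_assoc]
    rw [potential_eq, potential_eq, det_one_add_vecMulVec hγ0 hh₁ hV, hreg,
      Real.sqrt_mul (posDef_one_add hV).det_pos.le, WithLp.ofLp_add, ← hc]
    rw [mul_comm (√_), ← div_div, div_mul_eq_mul_div]
    exact div_le_div_of_nonneg_right h1 hdet.le

theorem potential_step {γ h₁ h : ℝ} (hγ : 1 < γ) (hh₁ : 0 < h₁) (hh : 0 < h)
    (G : EuclideanSpace ℝ (Fin d)) {V : Matrix (Fin d) (Fin d) ℝ} (hV : V.PosSemidef)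
    {g : EuclideanSpace ℝ (Fin d)} (hg : ‖g‖ ≤ h) :
    potential γ 1 h₁ (G + g) (V + Matrix.vecMulVec g.ofLp g.ofLp) h
      ≤ potential γ 1 h₁ G V h + ⟪g, gradient (fun G => potential γ 1 h₁ G V h) G⟫ := by
  obtain ⟨v, h1, h2⟩ := exists_hasGradientAt_potential hγ hh₁ hh G hV
  rw [h1.gradient, real_inner_smul_right, inner_eq_dotProduct, dotProduct_comm]
  refine (h2 g hg).trans (le_of_eq ?_)
  ring

/-- A larger hint lowers the cost `ρ²/(2h²)` of the multiplier. Raising the hint between rounds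
therefore never raises the potential. -/
theorem potential_anti {γ h₁ h h' : ℝ} (hγ : 1 < γ) (hh₁ : 0 < h₁) (hh : 0 < h) (hle : h ≤ h')
    (G : EuclideanSpace ℝ (Fin d)) {V : Matrix (Fin d) (Fin d) ℝ} (hV : V.PosSemidef) :
    potential γ 1 h₁ G V h' ≤ potential γ 1 h₁ G V h := by
  rw [potential_eq, potential_eq]
  refine div_le_div_of_nonneg_right (Real.exp_le_exp.2 ?_) (Real.sqrt_nonneg _)
  refine exponent_mono (posDef_regGram (by linarith) hh₁ hV) (by positivity) ?_ _
  gcongr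

theorem potential_zero_le {γ h₁ : ℝ} (hγ : 1 < γ) (hh₁ : 0 < h₁) (h : ℝ) :
    potential γ 1 h₁ (0 : EuclideanSpace ℝ (Fin d)) 0 h ≤ 1 := by
  rw [potential_eq]
  have h1 := exponent_zero_le (posDef_regGram (d := d) (by linarith : 0 < γ) hh₁
    Matrix.PosSemidef.zero) (show 0 ≤ rho γ ^ 2 / (2 * h ^ 2) by positivity)
  simpa using h1

/-! ### Wealth and regret over all rounds -/

theorem posSemidef_gradGram (g : ℕ → EuclideanSpace ℝ (Fin d)) (t : ℕ) :
    (gradGram g t).PosSemidef :=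
  Matrix.posSemidef_sum _ fun _ _ => posSemidef_vecMulVec_self _

theorem gradSum_succ (g : ℕ → EuclideanSpace ℝ (Fin d)) (t : ℕ) :
    gradSum g (t + 1) = gradSum g t + g (t + 1) :=
  Finset.sum_Icc_succ_top (by omega) _

theorem gradGram_succ (g : ℕ → EuclideanSpace ℝ (Fin d)) (t : ℕ) :
    gradGram g (t + 1) = gradGram g t + Matrix.vecMulVec (g (t + 1)).ofLp (g (t + 1)).ofLp :=
  Finset.sum_Icc_succ_top (by omega) _

theorem one_le_det_gradGram {h₁ : ℝ} (hh : 0 < h₁) (g : ℕ → EuclideanSpace ℝ (Fin d)) (t : ℕ) :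
    1 ≤ (1 + (1 / h₁ ^ 2) • gradGram g t).det := by
  induction t with
  | zero => simp [gradGram]
  | succ t ih =>
    rw [gradGram_succ, det_one_add_vecMulVec one_pos hh (posSemidef_gradGram g t)]
    have := dotProduct_mulVec_self_nonneg
      (posDef_regGram one_pos hh (posSemidef_gradGram g t)).inv.posSemidef (g (t + 1)).ofLp
    nlinarith

theorem norm_le_hint (x : ℕ → EuclideanSpace ℝ (Fin d)) {s t : ℕ} (hs : s ∈ Finset.Icc 1 t) :
    ‖x s‖ ≤ hint x t := by
  have := Finset.le_sup (f := fun s => ‖x s‖₊) hs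
  exact_mod_cast this

theorem hint_mono (x : ℕ → EuclideanSpace ℝ (Fin d)) {s t : ℕ} (hst : s ≤ t) :
    hint x s ≤ hint x t := by
  have := Finset.sup_mono (f := fun s => ‖x s‖₊) (Finset.Icc_subset_Icc_right (a := 1) hst)
  exact_mod_cast this

theorem hint_pos {x : ℕ → EuclideanSpace ℝ (Fin d)} (hx : x 1 ≠ 0) {t : ℕ} (ht : 1 ≤ t) :
    0 < hint x t :=
  lt_of_lt_of_le (norm_pos_iff.2 hx) (norm_le_hint x (Finset.mem_Icc.2 ⟨le_rfl, ht⟩))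

theorem differentiableAt_potential {γ : ℝ} (hγ : 1 < γ) {x : ℕ → EuclideanSpace ℝ (Fin d)}
    (hx : x 1 ≠ 0) (δ : ℕ → ℝ) {t : ℕ} (ht : 1 ≤ t) :
    DifferentiableAt ℝ (fun G : EuclideanSpace ℝ (Fin d) =>
      potential γ 1 (hint x 1) G (gradGram (subgrad x δ) (t - 1)) (hint x t))
      (gradSum (subgrad x δ) (t - 1)) := by
  obtain ⟨v, h, -⟩ := exists_hasGradientAt_potential hγ (hint_pos hx le_rfl) (hint_pos hx ht)
    (gradSum (subgrad x δ) (t - 1)) (posSemidef_gradGram (subgrad x δ) (t - 1))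
  exact h.differentiableAt

/-- The wealth bound: the linearised loss of the predictions is paid for by the potential. -/
theorem sum_mul_prediction_le {γ : ℝ} (hγ : 1 < γ) {x : ℕ → EuclideanSpace ℝ (Fin d)}
    (hx : x 1 ≠ 0) (δ : ℕ → ℝ) (T : ℕ) (hδ : ∀ t ∈ Finset.Icc 1 T, |δ t| ≤ 1) :
    ∀ h, hint x T ≤ h → ∑ t ∈ Finset.Icc 1 T, δ t * prediction γ x δ t
      ≤ 1 - potential γ 1 (hint x 1) (gradSum (subgrad x δ) T) (gradGram (subgrad x δ) T) h := by
  have hh₁ := hint_pos hx le_rfl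
  induction T with
  | zero =>
    intro h _
    have := potential_zero_le (d := d) hγ hh₁ h
    simpa [gradSum, gradGram] using this
  | succ T ih =>
    intro h hle
    have hT := hint_pos hx (show 1 ≤ T + 1 by omega)
    -- The hint `h_{T+1}` is known before the prediction, so the earlier rounds are bounded at that
    -- hint already.
    have h1 := ih (fun t ht => hδ t (Finset.Icc_subset_Icc_right (by omega) ht)) (hint x (T + 1))
      (hint_mono x (by omega))
    have hmem : T + 1 ∈ Finset.Icc 1 (T + 1) := Finset.mem_Icc.2 ⟨by omega, le_rfl⟩
    have hg : ‖subgrad x δ (T + 1)‖ ≤ hint x (T + 1) := by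
      rw [subgrad, norm_smul, Real.norm_eq_abs]
      have := norm_le_hint x hmem
      have := mul_le_mul (hδ _ hmem) this (norm_nonneg _) zero_le_one
      linarith
    have h2 := potential_step hγ hh₁ hT (gradSum (subgrad x δ) T)
      (posSemidef_gradGram (subgrad x δ) T) hg
    have h3 := potential_anti hγ hh₁ hT hle (gradSum (subgrad x δ) (T + 1))
      (posSemidef_gradGram (subgrad x δ) (T + 1))
    rw [← gradSum_succ, ← gradGram_succ] at h2
    rw [Finset.sum_Icc_succ_top (by omega)]
    have h4 : δ (T + 1) * prediction γ x δ (T + 1) = - ⟪subgrad x δ (T + 1),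
        gradient (fun G => potential γ 1 (hint x 1) G (gradGram (subgrad x δ) T) (hint x (T + 1)))
          (gradSum (subgrad x δ) T)⟫ := by
      rw [prediction, matrixFreeGrad, inner_neg_right, subgrad, real_inner_smul_left]
      simp only [Nat.add_sub_cancel]
      ring
    linarith

theorem abs_le_one_of_isSubgradientAt {f : ℝ → ℝ} (hf : LipschitzWith 1 f) {a z : ℝ}
    (ha : IsSubgradientAt f a z) : |a| ≤ 1 := by
  have h1 := ha (z + 1)
  have h2 := ha (z - 1)
  have h3 := (abs_le.1 (by simpa [Real.dist_eq] using hf.dist_le_mul (z + 1) z)).2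
  have h4 := (abs_le.1 (by simpa [Real.dist_eq] using hf.dist_le_mul (z - 1) z)).2
  rw [abs_le]
  constructor <;> linarith

theorem detFactor_eq {γ : ℝ} (hγ : 0 < γ) {x : ℕ → EuclideanSpace ℝ (Fin d)} (hx : x 1 ≠ 0)
    (δ : ℕ → ℝ) (T : ℕ) :
    detFactor γ x δ T = (1 + (1 / hint x 1 ^ 2) • gradGram (subgrad x δ) T).det := by
  have hh₁ := hint_pos hx le_rfl
  have hA := posDef_one_add (h₁ := hint x 1) (posSemidef_gradGram (subgrad x δ) T)
  have hP : precision γ x δ T = regGram γ (hint x 1) (gradGram (subgrad x δ) T) := rfl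
  have hk : IsUnit (γ * hint x 1 ^ 2) := (by positivity : γ * hint x 1 ^ 2 ≠ 0).isUnit
  have hdet := (Matrix.isUnit_iff_isUnit_det _).1 hA.isUnit
  rw [detFactor, hP, regGram_eq_smul hh₁]
  obtain ⟨k, hk⟩ := hk
  rw [← hk]
  have : ((k : ℝ) • (1 + (1 / hint x 1 ^ 2) • gradGram (subgrad x δ) T))⁻¹
      = ((k : ℝ)⁻¹) • (1 + (1 / hint x 1 ^ 2) • gradGram (subgrad x δ) T)⁻¹ := by
    apply Matrix.inv_eq_left_inv
    rw [Matrix.smul_mul, Matrix.mul_smul, smul_smul, Matrix.nonsing_inv_mul _ hdet,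
      inv_mul_cancel₀ k.ne_zero, one_smul]
  rw [this, smul_smul, mul_inv_cancel₀ k.ne_zero, one_smul, Matrix.det_nonsing_inv,
    Ring.inverse_eq_inv', inv_inv]

/-- Fenchel conjugacy: the comparator term against the final potential. -/
theorem neg_inner_sub_potential_le {γ : ℝ} (hγ : 1 < γ) {x : ℕ → EuclideanSpace ℝ (Fin d)}
    (hx : x 1 ≠ 0) (δ : ℕ → ℝ) {T : ℕ} (hT : 1 ≤ T) (w : EuclideanSpace ℝ (Fin d)) :
    -⟪w, gradSum (subgrad x δ) T⟫
        - potential γ 1 (hint x 1) (gradSum (subgrad x δ) T) (gradGram (subgrad x δ) T) (hint x T)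
      ≤ √(complexity γ x δ T w * lnPlus (detFactor γ x δ T * complexity γ x δ T w)) := by
  have hγ0 : 0 < γ := by linarith
  have hh₁ := hint_pos hx le_rfl
  have hh := hint_pos hx hT
  obtain ⟨hr0, -, -⟩ := rho_spec hγ
  set G := gradSum (subgrad x δ) T
  rw [potential_eq, complexity, ← detFactor_eq hγ0 hx]
  have hD : 1 ≤ detFactor γ x δ T := by
    rw [detFactor_eq hγ0 hx]; exact one_le_det_gradGram hh₁ _ _
  have hP : precision γ x δ T = regGram γ (hint x 1) (gradGram (subgrad x δ) T) := rfl
  rw [hP]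
  have hS := posDef_regGram hγ0 hh₁ (posSemidef_gradGram (subgrad x δ) T)
  set S := regGram γ (hint x 1) (gradGram (subgrad x δ) T)
  set D := detFactor γ x δ T
  set h := hint x T
  -- The scale `η` requires `A, B > 0`, so `w = 0` is treated apart.
  rcases eq_or_ne w 0 with rfl | hw
  · refine le_trans ?_ (Real.sqrt_nonneg _)
    rw [inner_zero_left, neg_zero, zero_sub]
    exact neg_nonpos.2 (by positivity)
  · have hw0 : 0 < ‖w‖ := norm_pos_iff.2 hw
    have hA : 0 < w.ofLp ⬝ᵥ (S *ᵥ w.ofLp) := by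
      have := hS.dotProduct_mulVec_pos (x := w.ofLp) (by simpa using hw)
      simpa using this
    have hB : 0 < h ^ 2 * ‖w‖ ^ 2 / rho γ ^ 2 := by positivity
    obtain ⟨η, hη, hBη, hle⟩ := exists_scale_le hA hB hD
    refine le_trans ?_ hle
    refine le_trans ?_ (sub_exp_div_sqrt_le (by linarith) hη (-⟪w, G⟫))
    -- The test vector `-w/η` lies in the dual ball exactly when `B ≤ η²`.
    have hv : ((-(1 / η)) • w.ofLp) ⬝ᵥ ((-(1 / η)) • w.ofLp)
        ≤ 2 * (rho γ ^ 2 / (2 * h ^ 2)) := by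
      rw [smul_dotProduct, dotProduct_smul, ← norm_sq_eq_dotProduct, smul_eq_mul, smul_eq_mul]
      rw [div_le_iff₀ (by positivity)] at hBη
      have : 2 * (rho γ ^ 2 / (2 * h ^ 2)) = rho γ ^ 2 / h ^ 2 := by field_simp
      rw [this, le_div_iff₀ (by positivity)]
      have : -(1 / η) * (-(1 / η) * ‖w‖ ^ 2) * h ^ 2 = h ^ 2 * ‖w‖ ^ 2 / η ^ 2 := by field_simp
      rw [this, div_le_iff₀ (by positivity)]
      linarith
    have h1 := le_exponent hS G.ofLp hv
    rw [Matrix.mulVec_smul, smul_dotProduct, smul_dotProduct, dotProduct_smul,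
      ← inner_eq_dotProduct] at h1
    simp only [smul_eq_mul] at h1
    refine sub_le_sub_left (div_le_div_of_nonneg_right (Real.exp_le_exp.2 ?_)
      (Real.sqrt_nonneg _)) _
    refine le_trans (le_of_eq ?_) h1
    field_simp

theorem regret_le {γ : ℝ} (hγ : 1 < γ) {x : ℕ → EuclideanSpace ℝ (Fin d)}
    (hx : x 1 ≠ 0) {δ : ℕ → ℝ} {loss : ℝ → ℝ → ℝ} (hloss : ∀ a : ℝ, LipschitzWith 1 (loss a))
    {y : ℕ → ℝ} {T : ℕ} (hT : 1 ≤ T)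
    (hδ : ∀ t ∈ Finset.Icc 1 T, IsSubgradientAt (loss (y t)) (δ t) (prediction γ x δ t))
    (w : EuclideanSpace ℝ (Fin d)) :
    regret loss x y (prediction γ x δ) T w
      ≤ 1 + √(complexity γ x δ T w * lnPlus (detFactor γ x δ T * complexity γ x δ T w)) := by
  have h1 := sum_mul_prediction_le hγ hx δ T
    (fun t ht => abs_le_one_of_isSubgradientAt (hloss _) (hδ t ht)) _ le_rfl
  have h2 := neg_inner_sub_potential_le hγ hx δ hT w
  have h3 : regret loss x y (prediction γ x δ) T w
      ≤ ∑ t ∈ Finset.Icc 1 T, δ t * prediction γ x δ t - ⟪w, gradSum (subgrad x δ) T⟫ := by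
    rw [regret, gradSum, inner_sum, ← Finset.sum_sub_distrib, ← Finset.sum_sub_distrib]
    refine Finset.sum_le_sum fun t ht => ?_
    have := hδ t ht ⟪w, x t⟫
    rw [subgrad, real_inner_smul_right]
    linarith
  linarith

end Potential

/-! ### Scale and rotation invariance -/

section Invariance

variable {d : ℕ}

theorem smul_mul_mul_transpose_quadratic {c : ℝ} (hc : 0 < c) {O : Matrix (Fin d) (Fin d) ℝ}
    (hO : O * Oᵀ = 1) {M : Matrix (Fin d) (Fin d) ℝ} (hM : M.PosDef) (u : Fin d → ℝ) :
    ((c • O) *ᵥ u) ⬝ᵥ ((c ^ 2 • (O * M * Oᵀ))⁻¹ *ᵥ ((c • O) *ᵥ u)) = u ⬝ᵥ (M⁻¹ *ᵥ u) := by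
  have hO' : Oᵀ * O = 1 := mul_eq_one_comm.1 hO
  have hdet := (Matrix.isUnit_iff_isUnit_det M).1 hM.isUnit
  have hinv : (c ^ 2 • (O * M * Oᵀ))⁻¹ = (c ^ 2)⁻¹ • (O * M⁻¹ * Oᵀ) := by
    apply Matrix.inv_eq_left_inv
    have h1 : O * M⁻¹ * Oᵀ * (O * M * Oᵀ) = O * (M⁻¹ * ((Oᵀ * O) * M)) * Oᵀ := by
      simp only [Matrix.mul_assoc]
    rw [Matrix.smul_mul, Matrix.mul_smul, smul_smul, inv_mul_cancel₀ (by positivity), one_smul, h1,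
      hO', Matrix.one_mul, Matrix.nonsing_inv_mul _ hdet, Matrix.mul_one, hO]
  have h2 : O * M⁻¹ * Oᵀ * O = O * M⁻¹ := by rw [Matrix.mul_assoc, hO', Matrix.mul_one]
  have h3 : (O *ᵥ u) ⬝ᵥ (O *ᵥ (M⁻¹ *ᵥ u)) = u ⬝ᵥ (M⁻¹ *ᵥ u) := by
    rw [Matrix.dotProduct_mulVec, ← Matrix.mulVec_transpose, Matrix.mulVec_mulVec, hO',
      Matrix.one_mulVec]
  rw [hinv, Matrix.smul_mulVec, Matrix.smul_mulVec, Matrix.mulVec_smul, Matrix.mulVec_mulVec, h2,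
    ← Matrix.mulVec_mulVec, smul_dotProduct, dotProduct_smul, dotProduct_smul, h3]
  simp only [smul_eq_mul]
  field_simp

/-- The map `l ↦ c² l` is a bijection of `[0, ∞)` matching the two infima term by term. -/
theorem exponent_rescale {c : ℝ} (hc : 0 < c) {O : Matrix (Fin d) (Fin d) ℝ}
    (hO : O * Oᵀ = 1) {S : Matrix (Fin d) (Fin d) ℝ} (hS : S.PosDef) (k : ℝ) (u : Fin d → ℝ) :
    exponent (c ^ 2 • (O * S * Oᵀ)) (k / c ^ 2) ((c • O) *ᵥ u) = exponent S k u := by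
  refine (Function.Surjective.iInf_congr
    (fun l : {l : ℝ // 0 ≤ l} => (⟨c ^ 2 * l.1, by have := l.2; positivity⟩ : {l : ℝ // 0 ≤ l}))
    ?_ ?_).symm
  · rintro ⟨l, hl⟩
    refine ⟨⟨l / c ^ 2, by positivity⟩, Subtype.ext ?_⟩
    simp only
    field_simp
  · rintro ⟨l, hl⟩
    have h1 : c ^ 2 • (O * S * Oᵀ) + (c ^ 2 * l) • (1 : Matrix (Fin d) (Fin d) ℝ)
        = c ^ 2 • (O * (S + l • (1 : Matrix (Fin d) (Fin d) ℝ)) * Oᵀ) := by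
      rw [Matrix.mul_add, Matrix.add_mul, Matrix.mul_smul, Matrix.smul_mul, Matrix.mul_one, hO,
        smul_add, smul_smul]
    simp only
    rw [h1, smul_mul_mul_transpose_quadratic hc hO (posDef_add_smul_one hS hl)]
    field_simp

theorem potential_rescale {γ h₁ h c : ℝ} (hγ : 0 < γ) (hh₁ : 0 < h₁) (hc : 0 < c)
    {O : Matrix (Fin d) (Fin d) ℝ} (hO : O * Oᵀ = 1)
    (G : EuclideanSpace ℝ (Fin d)) {V : Matrix (Fin d) (Fin d) ℝ} (hV : V.PosSemidef) :
    potential γ 1 (c * h₁) (WithLp.toLp 2 ((c • O) *ᵥ G.ofLp)) (c ^ 2 • (O * V * Oᵀ)) (c * h)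
      = potential γ 1 h₁ G V h := by
  have h1 : regGram γ (c * h₁) (c ^ 2 • (O * V * Oᵀ)) = c ^ 2 • (O * regGram γ h₁ V * Oᵀ) := by
    simp only [regGram, Matrix.mul_add, Matrix.add_mul, Matrix.mul_smul, Matrix.smul_mul,
      Matrix.mul_one, hO, smul_add, smul_smul]
    congr 2 <;> ring
  have h2 : (1 + (1 / (c * h₁) ^ 2) • c ^ 2 • (O * V * Oᵀ)).det
      = (1 + (1 / h₁ ^ 2) • V).det := by
    have h3 : 1 + (1 / (c * h₁) ^ 2) • c ^ 2 • (O * V * Oᵀ)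
        = O * (1 + (1 / h₁ ^ 2) • V) * Oᵀ := by
      simp only [Matrix.mul_add, Matrix.add_mul, Matrix.mul_smul, Matrix.smul_mul,
        Matrix.mul_one, hO, smul_smul]
      congr 2
      field_simp
    rw [h3, Matrix.det_mul_right_comm, hO, Matrix.one_mul]
  have h4 : rho γ ^ 2 / (2 * (c * h) ^ 2) = rho γ ^ 2 / (2 * h ^ 2) / c ^ 2 := by
    rw [div_div]; ring
  rw [potential_eq, potential_eq, h1, h2, h4,
    exponent_rescale hc hO (posDef_regGram hγ hh₁ hV)]

theorem subgrad_rescale (c : ℝ) (O : Matrix (Fin d) (Fin d) ℝ)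
    (x : ℕ → EuclideanSpace ℝ (Fin d)) (δ : ℕ → ℝ) (t : ℕ) :
    subgrad (rescale c O x) δ t = WithLp.toLp 2 ((c • O) *ᵥ (subgrad x δ t).ofLp) := by
  simp only [subgrad, rescale, WithLp.ofLp_smul, Matrix.mulVec_smul, WithLp.toLp_smul]

theorem gradSum_rescale (c : ℝ) (O : Matrix (Fin d) (Fin d) ℝ)
    (x : ℕ → EuclideanSpace ℝ (Fin d)) (δ : ℕ → ℝ) (t : ℕ) :
    gradSum (subgrad (rescale c O x) δ) t
      = WithLp.toLp 2 ((c • O) *ᵥ (gradSum (subgrad x δ) t).ofLp) := by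
  simp only [gradSum, subgrad_rescale, WithLp.ofLp_sum, Matrix.mulVec_sum, WithLp.toLp_sum]

theorem gradGram_rescale (c : ℝ) (O : Matrix (Fin d) (Fin d) ℝ)
    (x : ℕ → EuclideanSpace ℝ (Fin d)) (δ : ℕ → ℝ) (t : ℕ) :
    gradGram (subgrad (rescale c O x) δ) t = c ^ 2 • (O * gradGram (subgrad x δ) t * Oᵀ) := by
  simp only [gradGram, subgrad_rescale, Finset.mul_sum, Finset.sum_mul, Finset.smul_sum]
  refine Finset.sum_congr rfl fun s _ => ?_
  rw [Matrix.mul_vecMulVec, Matrix.vecMulVec_mul, Matrix.vecMul_transpose, Matrix.smul_mulVec,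
    Matrix.smul_vecMulVec, Matrix.vecMulVec_smul, smul_smul, pow_two]

theorem norm_rescale {c : ℝ} (hc : 0 < c) {O : Matrix (Fin d) (Fin d) ℝ} (hO : O * Oᵀ = 1)
    (x : ℕ → EuclideanSpace ℝ (Fin d)) (t : ℕ) : ‖rescale c O x t‖ = c * ‖x t‖ := by
  have hO' : Oᵀ * O = 1 := mul_eq_one_comm.1 hO
  rw [← sq_eq_sq₀ (norm_nonneg _) (by positivity), mul_pow, norm_sq_eq_dotProduct,
    norm_sq_eq_dotProduct, rescale]
  simp only
  rw [Matrix.dotProduct_mulVec, ← Matrix.mulVec_transpose, Matrix.mulVec_mulVec,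
    Matrix.transpose_smul, Matrix.smul_mul, Matrix.mul_smul, hO', smul_smul, Matrix.smul_mulVec,
    Matrix.one_mulVec, smul_dotProduct, smul_eq_mul, pow_two]

theorem hint_rescale {c : ℝ} (hc : 0 < c) {O : Matrix (Fin d) (Fin d) ℝ} (hO : O * Oᵀ = 1)
    (x : ℕ → EuclideanSpace ℝ (Fin d)) (t : ℕ) : hint (rescale c O x) t = c * hint x t := by
  have h : ∀ s, ‖rescale c O x s‖₊ = c.toNNReal * ‖x s‖₊ := fun s => by
    apply NNReal.eq
    simp [norm_rescale hc hO, hc.le]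
  simp only [hint, h, ← NNReal.mul_finset_sup, NNReal.coe_mul, Real.coe_toNNReal c hc.le]

/-- The potential is `F' ∘ L` with `L = c O`, and `L` maps the old `x_t` and `G_{t-1}` to the new
ones. By the chain rule both predictions are minus the same directional derivative. -/
theorem prediction_rescale {γ : ℝ} (hγ : 1 < γ) {x : ℕ → EuclideanSpace ℝ (Fin d)}
    (hx : x 1 ≠ 0) (δ : ℕ → ℝ) {c : ℝ} (hc : 0 < c) {O : Matrix (Fin d) (Fin d) ℝ}
    (hO : O * Oᵀ = 1) {t : ℕ} (ht : 1 ≤ t) :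
    prediction γ (rescale c O x) δ t = prediction γ x δ t := by
  have hx' : rescale c O x 1 ≠ 0 := by
    rw [← norm_pos_iff, norm_rescale hc hO]
    exact mul_pos hc (norm_pos_iff.2 hx)
  have hd := (differentiableAt_potential hγ hx' δ ht).hasFDerivAt
  set F' := fun G : EuclideanSpace ℝ (Fin d) =>
    potential γ 1 (hint (rescale c O x) 1) G (gradGram (subgrad (rescale c O x) δ) (t - 1))
      (hint (rescale c O x) t) with hF'
  set L := Matrix.toEuclideanCLM (n := Fin d) (𝕜 := ℝ) (c • O) with hL
  have hLa : ∀ u : EuclideanSpace ℝ (Fin d), L u = WithLp.toLp 2 ((c • O) *ᵥ u.ofLp) := fun u => by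
    rw [hL, ← Matrix.ofLp_toEuclideanCLM]
  have hcomp : (fun G : EuclideanSpace ℝ (Fin d) =>
      potential γ 1 (hint x 1) G (gradGram (subgrad x δ) (t - 1)) (hint x t)) = F' ∘ L := by
    funext G
    simp only [hF', Function.comp_apply, hLa, hint_rescale hc hO, gradGram_rescale]
    exact (potential_rescale (by linarith) (hint_pos hx le_rfl) hc hO G
      (posSemidef_gradGram _ _)).symm
  have hG : gradSum (subgrad (rescale c O x) δ) (t - 1) = L (gradSum (subgrad x δ) (t - 1)) := by
    rw [hLa, gradSum_rescale]
  have hxt : rescale c O x t = L (x t) := (hLa _).symm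
  rw [hG] at hd
  have hfd := (hd.comp _ L.hasFDerivAt).fderiv
  rw [prediction, prediction, matrixFreeGrad, matrixFreeGrad, inner_neg_right, inner_neg_right,
    real_inner_comm, real_inner_comm _ (x t), inner_gradient_left, inner_gradient_left, hcomp, hfd,
    hG, hxt, ← hF']
  rfl

end Invariance

end OnlineLinear

theorem theorem8 {d : ℕ} (γ : ℝ) (hγ : 1 < γ) (x : ℕ → EuclideanSpace ℝ (Fin d))
    (hx : x 1 ≠ 0) (δ : ℕ → ℝ) :
    -- the gradients that define the iterates exist
    (∀ t : ℕ, 1 ≤ t → DifferentiableAt ℝ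
      (fun G : EuclideanSpace ℝ (Fin d) =>
        OnlineLinear.potential γ 1 (OnlineLinear.hint x 1) G
          (OnlineLinear.gradGram (OnlineLinear.subgrad x δ) (t - 1)) (OnlineLinear.hint x t))
      (OnlineLinear.gradSum (OnlineLinear.subgrad x δ) (t - 1))) ∧
    -- scale and rotation invariance of the predictions
    (∀ c : ℝ, 0 < c → ∀ O ∈ Matrix.specialOrthogonalGroup (Fin d) ℝ, ∀ t : ℕ, 1 ≤ t →
      OnlineLinear.prediction γ (OnlineLinear.rescale c O x) δ t
        = OnlineLinear.prediction γ x δ t) ∧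
    -- the regret bound
    (∀ loss : ℝ → ℝ → ℝ, (∀ a : ℝ, ConvexOn ℝ Set.univ (loss a)) →
      (∀ a : ℝ, LipschitzWith 1 (loss a)) →
      ∀ (y : ℕ → ℝ) (T : ℕ), 1 ≤ T →
      (∀ t ∈ Finset.Icc 1 T, OnlineLinear.IsSubgradientAt (loss (y t)) (δ t)
        (OnlineLinear.prediction γ x δ t)) →
      ∀ w : EuclideanSpace ℝ (Fin d),
        OnlineLinear.regret loss x y (OnlineLinear.prediction γ x δ) T w
          ≤ 1 + Real.sqrt (OnlineLinear.complexity γ x δ T w *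
              OnlineLinear.lnPlus
                (OnlineLinear.detFactor γ x δ T * OnlineLinear.complexity γ x δ T w))) := by
  refine ⟨fun t ht => OnlineLinear.differentiableAt_potential hγ hx δ ht,
    fun c hc O hO t ht => ?_, fun loss _ hlip y T hT hδ w => ?_⟩
  · have h := (Matrix.mem_orthogonalGroup_iff (Fin d) ℝ).1
      (Matrix.mem_specialOrthogonalGroup_iff.1 hO).1
    exact OnlineLinear.prediction_rescale hγ hx δ hc h ht
  · exact OnlineLinear.regret_le hγ hx hlip hT hδ w
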